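/- **Setting.** Let $\mathcal S$ be a finite set of vertices with nonnegative weights $w$ and a cost $c(u,v)$, and let $m\ge 1$ robots with identifiers $1,\dots,m$ stand on vertices $Q=(q_1,\dots,q_m)\in\mathcal S^m$ (positions may coincide). The coverage cost is $\mathcal D(Q)=\sum_{v\in\mathcal S}\min_{i} w(v)c(v,q_i)$, and $Q^*$ denotes a configuration minimizing $\mathcal D$ over $\mathcal S^m$. Let $W_i$ be the set of vertices whose closest robot is $i$, ties going to the smaller identifier. The vertices, the cost and the neighbour sets $\mathcal N(i)\ni i$ arise in one of two ways. (a) *Graph.* $\mathcal S$ is the vertex set of a finite connected graph with nonnegative edge costs, and $c$ is the shortest-path cost (so $c$ agrees with the edge costs if these are metric). Put a dummy vertex of weight $0$ in the middle of every edge, let $\overline W_i\supseteq W_i$ be the cell of robot $i$ in the resulting graph (same tie rule), and let $r_i=\max_{p\in\overline W_i}c(p,q_i)$ (with $r_i=0$ if $\overline W_i=\emptyset$). Then $j\in\mathcal N(i)$ iff $c(q_i,q_j)\le 4\max\{r_i,r_j\}$. (b) *Sampled environment.* $\mathcal S$ is a finite subset of a compact space $\mathcal X$ in which $d(p,q)$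 is the length of a shortest path from $p$ to $q$, and $c(u,v)=f(d(u,v))$ with $f:\mathbb R_{+}\to\mathbb R_{+}$ strictly increasing and subadditive. Let $V_i=\{p\in\mathcal X: d(p,q_i)\le d(p,q_j)\ \forall j\}$ and $r_i=\max_{p\in V_i}d(p,q_i)$. Then $j\in\mathcal N(i)$ iff $d(q_i,q_j)\le 4\max\{r_i,r_j\}$. **Algorithm** with parameter $\varepsilon_0>0$. In a configuration $Q$ a robot $i$ with $\sum_{u\in W_i}c(u,q_i)>0$ looks for a local move as follows. *Type 1.* For $v\in W_i$ let $\delta_v$ be the change of the cost of the cells $W_j$, $j\in\mathcal N(i)$, computed with the robots of $\mathcal N(i)$ only, if $i$ moves to $v$. If $\min_{v\in W_i}\delta_v\le-\varepsilon_0$, robot $i$ moves to a minimizer. *Type 2.* Otherwise, with $R_j(v)=\{u\in W_j: c(u,v)<c(u,q_j)\}$, robot $i$ computes $\rho_v=\sum_{j\in\mathcal N(i)}\sum_{u\in R_j(v)}w(u)[c(u,v)-c(u,q_j)]$ for $v\in W_i$ and sends these values with counter $1$ to its neighbours. A robot $k$ that first receives the message, with counter $n$, from a robot called its parent computes $L_v=\sum_{u\in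 W_k\setminus R_k(v)}w(u)\bigl[\min\{c(u,v),\min_{j\in\mathcal N(k)\setminus\{k\}}c(u,q_j)\}-c(u,q_k)\bigr]$ if $n=1$, and $L_v=\sum_{u\in W_k}w(u)\bigl[\min_{j\in\mathcal N(k)\setminus\{k\}}c(u,q_j)-c(u,q_k)\bigr]$ if $n>1$. If $\rho_v+L_v\le-\varepsilon_0$ for some $v\in W_i$, robot $k$ accepts; otherwise it forwards the message with counter $n+1$ to its neighbours. If some robot accepts, the pair $(k,v)$ with the least value $\rho_v+L_v$ over the accepting robots $k$ and $v\in W_i$ is carried out: $i$ moves to $v$, and each robot on the chain of parents from $k$ to $i$, other than $i$, moves to its parent's old position. At the start all robots are active. In any order, active robots take turns: an active robot that has a local move makes it, after which all robots are active; an active robot that has no local move becomes inactive. The algorithm terminates when all robots are inactive. **Theorem.** In both settings (a) and (b), when the algorithm terminates, from any initial configuration, its final configuration $Q$ is within a factor $5+o(\varepsilon_0)$ of the optimum. Precisely: 1. for every $\varepsilon_0>0$, $\mathcal D(Q)\le 5\,\mathcal D(Q^*)+m\,\varepsilon_0$; 2. for every fixed instance $(\mathcal S,c,w,\mathcal N,m)$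 there is a function $g$ with $g(\varepsilon_0)=o(\varepsilon_0)$ as $\varepsilon_0\to0^+$ such that, for all sufficiently small $\varepsilon_0>0$, every final configuration $Q$ satisfies $\mathcal D(Q)\le(5+g(\varepsilon_0))\,\mathcal D(Q^*)$. -/

import Mathlib

open Filter Topology Asymptotics

noncomputable section

namespace Coverage

/-! ### Configurations, cells and the coverage cost

`m` robots, named by their unique identifiers in `Fin m`, stand on the vertices of a finite set `V`.
A configuration is a map `Q : Fin m → V`; `c u v` is the sensing cost between vertices and `w` the
weight of the vertices. -/

/-- The coverage cost `∑ v, min_{q ∈ Q} w v * c v q`. -/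
def cost {V : Type*} [Fintype V] {m : ℕ} (c : V → V → ℝ) (w : V → ℝ) (Q : Fin m → V) : ℝ :=
  ∑ v, ⨅ j, w v * c v (Q j)

/-- `Q` has the least coverage cost among all configurations of `m` robots. -/
def IsOptimal {V : Type*} [Fintype V] {m : ℕ} (c : V → V → ℝ) (w : V → ℝ) (Q : Fin m → V) : Prop :=
  ∀ Q' : Fin m → V, cost c w Q ≤ cost c w Q'

/-- The cell of robot `i`: the points that are closest to robot `i`, a tie being won by the robot
with the smaller identifier. Here `κ p j` is the distance from the point `p` to robot `j`. -/
def cell {P : Type*} {m : ℕ} (κ : P → Fin m → ℝ) (i : Fin m) : Set P :=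
  {p | ∀ j, κ p i ≤ κ p j ∧ (j < i → κ p i < κ p j)}

/-- The partition `W_i(Q)` of the vertices. -/
def W {V : Type*} {m : ℕ} (c : V → V → ℝ) (Q : Fin m → V) (i : Fin m) : Set V :=
  cell (fun u j => c u (Q j)) i

/-! ### The distributed algorithm

`N Q i j` says that robot `j` is a neighbour of robot `i` in the configuration `Q` (every robot is a
neighbour of itself). -/

section Algorithm

variable {V : Type*} [Fintype V] {m : ℕ} (c : V → V → ℝ) (w : V → ℝ)
  (N : (Fin m → V) → Fin m → Fin m → Prop) (ε₀ : ℝ)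

open scoped Classical in
/-- `δ_v`: the change of the cost of the cells of the neighbours of robot `i` (its own cell
included) if robot `i` moves to `v`, computed from the positions of these neighbours. -/
def delta (Q : Fin m → V) (i : Fin m) (v : V) : ℝ :=
  ∑ j with N Q i j, ∑ u with u ∈ W c Q j,
    w u * ((⨅ k : {k // N Q i k}, c u (Function.update Q i v k)) - c u (Q j))

open scoped Classical in
/-- `ρ_v`: the change of the cost of these cells if robot `i` moves to `v` and a new robot appears
at the old position of robot `i`. The inner sum is over `R_j(v)`. -/
def rho (Q : Fin m → V) (i : Fin m) (v : V) : ℝ :=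
  ∑ j with N Q i j, ∑ u with u ∈ W c Q j ∧ c u v < c u (Q j), w u * (c u v - c u (Q j))

/-- The sensing cost of `u` by the best neighbour of robot `k` other than robot `k` itself. -/
def otherCost (Q : Fin m → V) (k : Fin m) (u : V) : ℝ :=
  ⨅ j : {j // N Q k j ∧ j ≠ k}, c u (Q j)

open scoped Classical in
/-- `ℓ_v`: the change of the cost of `W_k \ R_k(v)` if robot `k` leaves its position, which is taken
up by the other neighbours of `k` and by the robot that has moved to `v`. -/
def lossNear (Q : Fin m → V) (k : Fin m) (v : V) : ℝ :=
  ∑ u with u ∈ W c Q k ∧ ¬ c u v < c u (Q k),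
    w u * (min (otherCost c N Q k u) (c u v) - c u (Q k))

open scoped Classical in
/-- `ℓ`: the change of the cost of `W_k` if robot `k` leaves its position, which is taken up by the
other neighbours of `k`. -/
def lossFar (Q : Fin m → V) (k : Fin m) : ℝ :=
  ∑ u with u ∈ W c Q k, w u * (otherCost c N Q k u - c u (Q k))

/-- The change that robot `k` computes for the proposal "robot `i` moves to `v`, robot `k` leaves its
position" when it receives the message of robot `i` with counter `n`. -/
def offer (Q : Fin m → V) (i : Fin m) (n : ℕ) (k : Fin m) (v : V) : ℝ :=
  rho c w N Q i v + if n = 1 then lossNear c w N Q k v else lossFar c w N Q k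

/-- Robot `k` accepts the message of robot `i` that it receives with counter `n`. -/
def Accepts (Q : Fin m → V) (i : Fin m) (n : ℕ) (k : Fin m) : Prop :=
  ∃ v ∈ W c Q i, offer c w N Q i n k v ≤ -ε₀

/-- How the message of robot `i` spreads. The second component is the set of robots that receive it
for the first time with counter `n` (for `n = 0`, the sender `i`), the first component the set of
robots that have it by then. A robot that accepts does not pass the message on; one that does not
accept sends it, with the counter increased by one, to its neighbours. -/
def spread (Q : Fin m → V) (i : Fin m) : ℕ → Set (Fin m) × Set (Fin m)
  | 0 => ({i}, {i})
  | n + 1 =>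
    let new : Set (Fin m) := {k | k ∉ (spread Q i n).1 ∧
      ∃ j ∈ (spread Q i n).2, (n = 0 ∨ ¬ Accepts c w N ε₀ Q i n j) ∧ N Q j k}
    ((spread Q i n).1 ∪ new, new)

/-- `k` receives the message of robot `i` for the first time with counter `n`. -/
def Receives (Q : Fin m → V) (i : Fin m) (n : ℕ) (k : Fin m) : Prop :=
  k ∈ (spread c w N ε₀ Q i n).2

/-- `p 0 = i, p 1, …, p n` is a chain of robots in which each `p t` is the parent of `p (t + 1)`:
the latter has first received the message of robot `i` from the former. -/
def IsParentChain (Q : Fin m → V) (i : Fin m) (n : ℕ) (p : ℕ → Fin m) : Prop :=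
  p 0 = i ∧ ∀ t < n, Receives c w N ε₀ Q i (t + 1) (p (t + 1)) ∧ N Q (p t) (p (t + 1)) ∧
    (t = 0 ∨ ¬ Accepts c w N ε₀ Q i t (p t))

/-- A local move of type 1: robot `i` moves inside its cell, to a vertex with the least `δ_v`. -/
def MoveOne (i : Fin m) (Q Q' : Fin m → V) : Prop :=
  ∃ v ∈ W c Q i, delta c w N Q i v ≤ -ε₀ ∧
    (∀ v' ∈ W c Q i, delta c w N Q i v ≤ delta c w N Q i v') ∧
    Q' = Function.update Q i v

/-- A local move of type 2, made when there is none of type 1: among all acceptances robot `i`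
selects the one with the largest improvement, coming from the robot `p n`; it moves to the vertex
`v`, and each robot of the chain from `i` to `p n` moves to the position of its parent. -/
def MoveTwo (i : Fin m) (Q Q' : Fin m → V) : Prop :=
  (∀ v ∈ W c Q i, -ε₀ < delta c w N Q i v) ∧
  ∃ (n : ℕ) (p : ℕ → Fin m), 1 ≤ n ∧ IsParentChain c w N ε₀ Q i n p ∧
    ∃ v ∈ W c Q i, offer c w N Q i n (p n) v ≤ -ε₀ ∧
      (∀ n' k' v', 1 ≤ n' → Receives c w N ε₀ Q i n' k' → v' ∈ W c Q i →
        offer c w N Q i n (p n) v ≤ offer c w N Q i n' k' v') ∧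
      Q' i = v ∧ (∀ t < n, Q' (p (t + 1)) = Q (p t)) ∧ ∀ k, (∀ t ≤ n, k ≠ p t) → Q' k = Q k

open scoped Classical in
/-- One iteration of the local move procedure of robot `i`, which is entered only if the
(unweighted) sensing cost of the cell of `i` is positive. -/
def LocalMove (i : Fin m) (Q Q' : Fin m → V) : Prop :=
  0 < ∑ u with u ∈ W c Q i, c u (Q i) ∧
    (MoveOne c w N ε₀ i Q Q' ∨ MoveTwo c w N ε₀ i Q Q')

/-- A step of the algorithm, on states that consist of a configuration and the set of active robots:
an active robot makes a local move, whereupon all robots have to check the new configuration and are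
active; or an active robot that cannot make a local move becomes inactive. The order in which the
active robots get their turns is arbitrary. -/
inductive Step : (Fin m → V) × Set (Fin m) → (Fin m → V) × Set (Fin m) → Prop
  | move {Q Q' : Fin m → V} {A : Set (Fin m)} {i : Fin m} (hi : i ∈ A)
      (h : LocalMove c w N ε₀ i Q Q') : Step (Q, A) (Q', Set.univ)
  | deactivate {Q : Fin m → V} {A : Set (Fin m)} {i : Fin m} (hi : i ∈ A)
      (h : ¬ ∃ Q', LocalMove c w N ε₀ i Q Q') : Step (Q, A) (Q, A \ {i})

/-- Started at `Q₀` with all robots active, the algorithm can terminate with the configuration `Q`: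
all robots are inactive. -/
def TerminatesAt (Q₀ Q : Fin m → V) : Prop :=
  Relation.ReflTransGen (Step c w N ε₀) (Q₀, Set.univ) (Q, ∅)

/-- The algorithm is a `5 + o(ε₀)` approximation. First, quantitatively and for every `ε₀ > 0`, the
final cost is at most `5 · OPT + m · ε₀`. Second, as `ε₀ → 0` on the given instance, the final cost is
at most `(5 + o(ε₀)) · OPT`. -/
def ApproxGuarantee : Prop :=
  (∀ ε₀ : ℝ, 0 < ε₀ → ∀ Q₀ Q Qopt : Fin m → V, TerminatesAt c w N ε₀ Q₀ Q → IsOptimal c w Qopt →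
    cost c w Q ≤ 5 * cost c w Qopt + m * ε₀) ∧
  ∃ g : ℝ → ℝ, g =o[𝓝[>] 0] (fun ε => ε) ∧
    ∀ᶠ ε₀ in 𝓝[>] (0 : ℝ), ∀ Q₀ Q Qopt : Fin m → V,
      TerminatesAt c w N ε₀ Q₀ Q → IsOptimal c w Qopt →
        cost c w Q ≤ (5 + g ε₀) * cost c w Qopt

end Algorithm

/-! ### Neighbours in a graph -/

section Graph

/-- Length of a shortest walk from `u` to `v`, if an edge from `x` to `y` has length `len x y`. -/
def graphDist {P : Type*} (G : SimpleGraph P) (len : P → P → ℝ) (u v : P) : ℝ :=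
  ⨅ p : G.Walk u v, (p.darts.map fun d => len d.fst d.snd).sum

variable {V : Type*} (G : SimpleGraph V) (len : Sym2 V → ℝ)

/-- The shortest path cost between the vertices of a graph with edge costs `len`. (If `len` is
metric, that is, no edge is longer than a walk between its ends, this agrees with `len` on the
edges.) -/
def graphCost (u v : V) : ℝ := graphDist G (fun x y => len s(x, y)) u v

/-- The graph in which a dummy vertex is placed in the middle of every edge. -/
def subdivision : SimpleGraph (V ⊕ G.edgeSet) where
  Adj
    | .inl u, .inr e => u ∈ e.1
    | .inr e, .inl u => u ∈ e.1
    | _, _ => False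
  symm := ⟨by rintro (u | e) (v | e') h <;> exact h⟩
  loopless := ⟨by rintro (u | e) h <;> exact h⟩

/-- Every edge of the subdivision is half of an edge of the graph. -/
def subdivisionLen : V ⊕ G.edgeSet → V ⊕ G.edgeSet → ℝ
  | .inl _, .inr e => len e.1 / 2
  | .inr e, .inl _ => len e.1 / 2
  | _, _ => 0

/-- Distance from a vertex of the subdivision to robot `j`. -/
def robotDist {m : ℕ} (Q : Fin m → V) (p : V ⊕ G.edgeSet) (j : Fin m) : ℝ :=
  graphDist (subdivision G) (subdivisionLen G len) p (.inl (Q j))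

/-- The largest distance to robot `i` in its cell of the subdivision (`0` if the cell is empty). -/
def cellRadius {m : ℕ} (Q : Fin m → V) (i : Fin m) : ℝ :=
  sSup ((fun p => robotDist G len Q p i) '' cell (robotDist G len Q) i)

/-- Neighbour robots in a graph. -/
def GraphNeighbour {m : ℕ} (Q : Fin m → V) (i j : Fin m) : Prop :=
  graphCost G len (Q i) (Q j) ≤ 4 * max (cellRadius G len Q i) (cellRadius G len Q j)

end Graph

/-! ### Neighbours in a continuous environment -/

section Environment

variable {X : Type*} [MetricSpace X]

/-- The distance of `X` is the length of a shortest path: any two points are joined by a path,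
parametrized by arc length, whose length is their distance. -/
def IsGeodesic (X : Type*) [MetricSpace X] : Prop :=
  ∀ p q : X, ∃ γ : ℝ → X, γ 0 = p ∧ γ (dist p q) = q ∧
    ∀ s ∈ Set.Icc 0 (dist p q), ∀ t ∈ Set.Icc 0 (dist p q), dist (γ s) (γ t) = |s - t|

/-- The Voronoi cell of robot `i` in the environment. -/
def voronoi {S : Finset X} {m : ℕ} (Q : Fin m → S) (i : Fin m) : Set X :=
  {p | ∀ j, dist p (Q i) ≤ dist p (Q j)}

/-- The largest distance to robot `i` in its Voronoi cell. -/
def voronoiRadius {S : Finset X} {m : ℕ} (Q : Fin m → S) (i : Fin m) : ℝ :=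
  sSup ((fun p => dist p (Q i : X)) '' voronoi Q i)

/-- Neighbour robots in a continuous environment. -/
def EnvNeighbour {S : Finset X} {m : ℕ} (Q : Fin m → S) (i j : Fin m) : Prop :=
  dist (Q i : X) (Q j) ≤ 4 * max (voronoiRadius Q i) (voronoiRadius Q j)

/-- The cost between sampled locations, for the sensing function `f`. -/
def envCost (S : Finset X) (f : ℝ → ℝ) (u v : S) : ℝ := f (dist (u : X) v)

end Environment

end Coverage

end

/-! This is the single-swap local search analysis for the k-median problem, run on the values the
robots compute. Let `η l` be the robot whose cell contains the optimal location `Qopt l`.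
`exists_swap_pairing` pairs each `l` with a robot `s l`, used at most twice, whose cell contains no
optimal location other than possibly `Qopt l`. Swap `s l` for `Qopt l`: vertices optimally served by
`l` go to `Qopt l`, and any other vertex `u` of the cell of `s l` goes to the robot `η (τ u)`, where
`τ u` is its optimal server; by the triangle inequality this costs at most twice the optimal cost of
`u` extra (`cost_closest_le`). This gives `swapBound`.

If `s l = η l`, the swap is a type 1 move, and `delta` is at most the bound; otherwise `s l`
contains no optimal location, the swap is a type 2 proposal, and `offer` is at most the bound.
Without local moves each bound is therefore at least `-ε₀` (`swapBound_ge`). Summing over `l` gives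
`-m ε₀ ≤ OPT - cost + 2 · 2 · OPT`. Only the computed values matter, not the true change of cost
under a move.

Geometry enters only through `IsNeighbourRelation`: neighbours see every gain, contain a best
substitute for a leaving robot, and form a connected graph. In both settings each required pair of
robots is at most three cell radii apart. -/

namespace Coverage

/-! ### Combinatorics of the swap pairing. -/

open scoped Classical in
/-- Every map of a finite set into itself admits a pairing for single swaps: `l` is swapped with
`s l`, no other point is mapped to `s l`, and no point is used more than twice. -/
theorem exists_swap_pairing {α : Type*} [Fintype α] (η : α → α) :
    ∃ s : α → α, (∀ l l', η l' = s l → l' = l) ∧ ∀ a, Fintype.card {l // s l = a} ≤ 2 := by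
  let deg : α → ℕ := fun a => (Finset.univ.filter fun l => η l = a).card
  have hdeg : ∀ l l', deg (η l) ≤ 1 → η l' = η l → l' = l := fun l l' h e =>
    Finset.card_le_one.1 h _ (by simp [e]) _ (by simp)
  have hcard : Fintype.card {l // 2 ≤ deg (η l)} ≤ Fintype.card ({a // deg a = 0} × Bool) := by
    rw [Fintype.card_prod, Fintype.card_bool, Fintype.card_subtype, Fintype.card_subtype]
    have h1 : (Finset.univ.filter fun l => 2 ≤ deg (η l)).card
        = ∑ a, if 2 ≤ deg a then deg a else 0 := by
      rw [Finset.card_eq_sum_card_fiberwise (f := η) (t := Finset.univ) (by simp)]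
      refine Finset.sum_congr rfl fun a _ => ?_
      split_ifs with h
      · refine congrArg Finset.card ?_
        ext l
        simp only [Finset.mem_filter, Finset.mem_univ, true_and, and_iff_right_iff_imp]
        rintro rfl
        exact h
      · rw [Finset.card_eq_zero, Finset.filter_eq_empty_iff]
        rintro l hl rfl
        exact h (by simpa using hl)
    have h2 : ∑ a, deg a = Fintype.card α := by
      rw [← Finset.card_univ,
        Finset.card_eq_sum_card_fiberwise (f := η) (s := Finset.univ) (t := Finset.univ) (by simp)]
    -- The degrees have average one, so the excess at points of degree at least two equals the
    -- number of points of degree zero; since `deg ≤ 2 (deg - 1)` there, two copies of the latter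
    -- suffice. This is the pointwise form.
    have h3 : ∑ a, ((if 2 ≤ deg a then deg a else 0) + 2)
        ≤ ∑ a, (2 * deg a + if deg a = 0 then 2 else 0) := by
      refine Finset.sum_le_sum fun a _ => ?_
      split_ifs <;> omega
    rw [Finset.sum_add_distrib, Finset.sum_add_distrib, ← Finset.mul_sum, h2, ← h1,
      ← Finset.sum_filter, Finset.sum_const, Finset.sum_const, Finset.card_univ] at h3
    simp only [smul_eq_mul] at h3
    omega
  obtain ⟨e⟩ := Function.Embedding.nonempty_of_card_le hcard
  -- A point hit only once is swapped with its preimage. Every other `l` gets a slot at a point of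
  -- degree zero, with two slots per point.
  refine ⟨fun l => if h : 2 ≤ deg (η l) then (e ⟨l, h⟩).1.1 else η l, ?_, ?_⟩
  · intro l l' h
    dsimp only at h
    split_ifs at h with h2
    · have h0 := (e ⟨l, h2⟩).1.2
      rw [← h, Finset.card_eq_zero, Finset.filter_eq_empty_iff] at h0
      exact (h0 (Finset.mem_univ l') rfl).elim
    · exact hdeg l l' (by omega) h
  · intro a
    by_cases ha : deg a = 0
    · have key : ∀ l, (if h : 2 ≤ deg (η l) then (e ⟨l, h⟩).1.1 else η l) = a →
          2 ≤ deg (η l) := by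
        intro l hl
        by_contra h
        rw [dif_neg h] at hl
        rw [Finset.card_eq_zero, Finset.filter_eq_empty_iff] at ha
        exact ha (Finset.mem_univ l) hl
      refine (Fintype.card_le_of_injective (fun l => (e ⟨l.1, key l.1 l.2⟩).2) ?_).trans_eq
        Fintype.card_bool
      rintro ⟨l, hl⟩ ⟨l', hl'⟩ h
      have h1 := key l hl
      have h2 := key l' hl'
      dsimp only at hl hl'
      rw [dif_pos h1] at hl
      rw [dif_pos h2] at hl'
      have := e.injective (Prod.ext (Subtype.ext (hl.trans hl'.symm)) h)
      simpa using this
    · refine (Fintype.card_le_of_injective (fun _ => true) ?_).trans_eq Fintype.card_bool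
      rintro ⟨l, hl⟩ ⟨l', hl'⟩ -
      have key : ∀ l, (if h : 2 ≤ deg (η l) then (e ⟨l, h⟩).1.1 else η l) = a →
          deg (η l) ≤ 1 ∧ η l = a := by
        intro l hl
        split_ifs at hl with h
        · exact (ha (hl ▸ (e ⟨l, h⟩).1.2)).elim
        · exact ⟨by omega, hl⟩
      exact Subtype.ext (hdeg l' l (key l' hl').1 ((key l hl).2.trans (key l' hl').2.symm))

/-! ### Cells and the tie rule. -/

section Cells

variable {P : Type*} {m : ℕ} {κ : P → Fin m → ℝ}

/-- Among the robots with a property, a point has a closest one, of smallest identifier. -/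
theorem exists_closest (κ : P → Fin m → ℝ) (p : P) (T : Fin m → Prop) (hT : ∃ i, T i) :
    ∃ i, T i ∧ ∀ j, T j → κ p i ≤ κ p j ∧ (j < i → κ p i < κ p j) := by
  classical
  obtain ⟨i, hi, hmin⟩ := Finset.exists_min_image (Finset.univ.filter T)
    (fun i => toLex (κ p i, i)) (hT.imp fun i hi => by simpa using hi)
  refine ⟨i, by simpa using hi, fun j hj => ?_⟩
  have := hmin j (by simpa using hj)
  rw [Prod.Lex.toLex_le_toLex] at this
  rcases this with h | ⟨h, h'⟩
  · exact ⟨h.le, fun _ => h⟩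
  · exact ⟨h.le, fun hji => (not_lt_of_ge h' hji).elim⟩

theorem exists_mem_cell (κ : P → Fin m → ℝ) (hm : 0 < m) (p : P) : ∃ i, p ∈ cell κ i := by
  obtain ⟨i, -, hi⟩ := exists_closest κ p (fun _ => True) ⟨⟨0, hm⟩, trivial⟩
  exact ⟨i, fun j => hi j trivial⟩

theorem cell_unique {p : P} {i j : Fin m} (hi : p ∈ cell κ i) (hj : p ∈ cell κ j) : i = j := by
  rcases lt_trichotomy i j with h | h | h
  · exact (not_lt_of_ge (hi j).1 ((hj i).2 h)).elim
  · exact h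
  · exact (not_lt_of_ge (hj i).1 ((hi j).2 h)).elim

end Cells

/-! ### Final configurations and the spread of messages. -/

section Algorithm

variable {V : Type*} [Fintype V] {m : ℕ} {c : V → V → ℝ} {w : V → ℝ}
  {N : (Fin m → V) → Fin m → Fin m → Prop} {ε₀ : ℝ}

/-- In a final configuration no robot has a local move. -/
theorem TerminatesAt.not_localMove {Q₀ Q : Fin m → V} (h : TerminatesAt c w N ε₀ Q₀ Q)
    (i : Fin m) (Q' : Fin m → V) : ¬ LocalMove c w N ε₀ i Q Q' := by
  -- Invariant: inactive robots have no local move. A move preserves it because it reactivates every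
  -- robot.
  have key : ∀ s : (Fin m → V) × Set (Fin m),
      Relation.ReflTransGen (Step c w N ε₀) (Q₀, Set.univ) s →
      ∀ i ∉ s.2, ¬ ∃ Q', LocalMove c w N ε₀ i s.1 Q' := by
    intro s hs
    induction hs with
    | refl => intro i hi; exact (hi trivial).elim
    | tail _ hstep ih =>
      cases hstep with
      | move hi h => intro j hj; exact (hj trivial).elim
      | @deactivate Q A i hi h =>
        intro j hj
        by_cases hji : j = i
        · exact hji ▸ h
        · exact ih j fun hjA => hj ⟨hjA, hji⟩
  exact fun hQ => key _ h i (Set.notMem_empty i) ⟨Q', hQ⟩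

variable {Q : Fin m → V} {i : Fin m}

theorem Receives.mem_spread {n : ℕ} {k : Fin m} (h : Receives c w N ε₀ Q i n k) :
    k ∈ (spread c w N ε₀ Q i n).1 := by
  cases n with
  | zero => exact h
  | succ n => exact Or.inr h

theorem spread_mono : Monotone fun n => (spread c w N ε₀ Q i n).1 :=
  monotone_nat_of_le_succ fun _ _ hk => Or.inl hk

/-- A robot receives the message for the first time only once. -/
theorem Receives.unique {n n' : ℕ} {k : Fin m} (h : Receives c w N ε₀ Q i n k)
    (h' : Receives c w N ε₀ Q i n' k) : n = n' := by
  have key : ∀ {a b : ℕ}, a < b → Receives c w N ε₀ Q i a k → ¬ Receives c w N ε₀ Q i b k := by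
    intro a b hab ha hb
    obtain ⟨b, rfl⟩ := Nat.exists_eq_succ_of_ne_zero (Nat.ne_zero_of_lt hab)
    exact hb.1 (spread_mono (Nat.lt_succ_iff.1 hab) ha.mem_spread)
  rcases lt_trichotomy n n' with hlt | heq | hlt
  · exact (key hlt h h').elim
  · exact heq
  · exact (key hlt h' h).elim

theorem exists_receives_of_mem_spread {n : ℕ} {k : Fin m}
    (h : k ∈ (spread c w N ε₀ Q i n).1) : ∃ n', Receives c w N ε₀ Q i n' k := by
  induction n with
  | zero => exact ⟨0, h⟩
  | succ n ih => exact h.elim ih fun h => ⟨n + 1, h⟩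

/-- A robot that has received the message has a chain of parents. -/
theorem Receives.exists_chain {n : ℕ} {k : Fin m} (h : Receives c w N ε₀ Q i n k) :
    ∃ p, IsParentChain c w N ε₀ Q i n p ∧ p n = k := by
  induction n generalizing k with
  | zero => exact ⟨fun _ => k, ⟨h, fun t ht => (Nat.not_lt_zero t ht).elim⟩, rfl⟩
  | succ n ih =>
    obtain ⟨-, j, hj, hacc, hN⟩ := id h
    obtain ⟨p, ⟨hp0, hp⟩, rfl⟩ := ih hj
    refine ⟨fun t => if t ≤ n then p t else k, ⟨by simpa using hp0, fun t ht => ?_⟩, by simp⟩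
    rcases Nat.lt_succ_iff_lt_or_eq.1 ht with hlt | rfl
    · simpa [hlt.le, Nat.succ_le_iff.2 hlt] using hp t hlt
    · simpa using ⟨h, hN, hacc⟩

theorem IsParentChain.receives {n : ℕ} {p : ℕ → Fin m} (h : IsParentChain c w N ε₀ Q i n p)
    {t : ℕ} (ht : t ≤ n) : Receives c w N ε₀ Q i t (p t) := by
  cases t with
  | zero => exact h.1
  | succ t => exact (h.2 t ht).1

/-- The move of type 2 along a chain of parents is well defined. -/
theorem IsParentChain.exists_shift {n : ℕ} {p : ℕ → Fin m} (h : IsParentChain c w N ε₀ Q i n p)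
    (v : V) : ∃ Q' : Fin m → V, Q' i = v ∧ (∀ t < n, Q' (p (t + 1)) = Q (p t)) ∧
      ∀ k, (∀ t ≤ n, k ≠ p t) → Q' k = Q k := by
  classical
  -- First reception happens only once, so the robots of a chain are distinct and the simultaneous
  -- shift is consistent.
  have hinj : ∀ {s t : ℕ}, s ≤ n → t ≤ n → p s = p t → s = t := fun hs ht hst =>
    (h.receives hs).unique (hst ▸ h.receives ht)
  refine ⟨fun k => if k = i then v else
    if hk : ∃ t < n, p (t + 1) = k then Q (p hk.choose) else Q k, if_pos rfl, fun t ht => ?_,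
    fun k hk => ?_⟩
  · have hne : p (t + 1) ≠ i := fun he =>
      Nat.succ_ne_zero t (hinj ht (Nat.zero_le n) (he.trans h.1.symm))
    have hex : ∃ t' < n, p (t' + 1) = p (t + 1) := ⟨t, ht, rfl⟩
    have : hex.choose = t := Nat.succ_injective
      (hinj hex.choose_spec.1 ht hex.choose_spec.2)
    dsimp only
    rw [if_neg hne, dif_pos hex, this]
  · have hne : k ≠ i := h.1 ▸ hk 0 (Nat.zero_le n)
    have hnex : ¬ ∃ t < n, p (t + 1) = k := fun ⟨t, ht, he⟩ => hk (t + 1) ht he.symm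
    dsimp only
    rw [if_neg hne, dif_neg hnex]

open scoped Classical in
/-- If a robot that enters the procedure has no local move, no vertex of its cell is an
improvement of type 1. -/
theorem neg_lt_delta (h : ∀ Q', ¬ LocalMove c w N ε₀ i Q Q')
    (hpos : 0 < ∑ u with u ∈ W c Q i, c u (Q i)) {v : V} (hv : v ∈ W c Q i) :
    -ε₀ < delta c w N Q i v := by
  by_contra! hle
  obtain ⟨v', hv', hmin⟩ := Finset.exists_min_image (Finset.univ.filter (· ∈ W c Q i))
    (delta c w N Q i) ⟨v, by simpa using hv⟩
  simp only [Finset.mem_filter, Finset.mem_univ, true_and] at hv' hmin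
  exact h _ ⟨hpos, Or.inl ⟨v', hv', (hmin v hv).trans hle, hmin, rfl⟩⟩

open scoped Classical in
/-- If a robot that enters the procedure has no local move, no robot accepts its message. -/
theorem neg_lt_offer (h : ∀ Q', ¬ LocalMove c w N ε₀ i Q Q')
    (hpos : 0 < ∑ u with u ∈ W c Q i, c u (Q i)) {n : ℕ} {k : Fin m} {v : V} (hn : 1 ≤ n)
    (hk : Receives c w N ε₀ Q i n k) (hv : v ∈ W c Q i) : -ε₀ < offer c w N Q i n k v := by
  by_contra! hle
  let A : Set (ℕ × Fin m × V) :=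
    {x | 1 ≤ x.1 ∧ Receives c w N ε₀ Q i x.1 x.2.1 ∧ x.2.2 ∈ W c Q i}
  let F : ℕ × Fin m × V → ℝ := fun x => offer c w N Q i x.1 x.2.1 x.2.2
  -- The counter ranges over all of `ℕ` but is determined by the receiver, so a least offer exists,
  -- as the type 2 move requires.
  have hfin : A.Finite := by
    refine Set.Finite.of_injOn (f := Prod.snd) (t := Set.univ) (fun _ _ => trivial) ?_
      Set.finite_univ
    rintro ⟨a, x⟩ hx ⟨b, y⟩ hy rfl
    exact Prod.ext (hx.2.1.unique hy.2.1) rfl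
  obtain ⟨⟨n', k', v'⟩, ⟨hn', hk', hv'⟩, hmin⟩ :=
    hfin.exists_minimalFor F A ⟨(n, k, v), hn, hk, hv⟩
  have hmin' : ∀ y ∈ A, F (n', k', v') ≤ F y := fun y hy =>
    (le_total (F (n', k', v')) (F y)).elim id (hmin hy)
  dsimp only at hn' hk' hv'
  obtain ⟨p, hp, rfl⟩ := hk'.exists_chain
  obtain ⟨Q', h1, h2, h3⟩ := hp.exists_shift v'
  exact h Q' ⟨hpos, Or.inr ⟨fun v hv => neg_lt_delta h hpos hv, n', p, hn', hp, v', hv',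
    (hmin' (n, k, v) ⟨hn, hk, hv⟩).trans hle,
    fun a b x ha hb hx => hmin' (a, b, x) ⟨ha, hb, hx⟩, h1, h2, h3⟩⟩

open scoped Classical in
/-- If a robot that enters the procedure has no local move, its message spreads along the
neighbour relation. -/
theorem exists_receives (h : ∀ Q', ¬ LocalMove c w N ε₀ i Q Q')
    (hpos : 0 < ∑ u with u ∈ W c Q i, c u (Q i)) {k : Fin m}
    (hk : Relation.ReflTransGen (N Q) i k) : ∃ n, Receives c w N ε₀ Q i n k := by
  induction hk with
  | refl => exact ⟨0, rfl⟩
  | @tail j k _ hjk ih =>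
    obtain ⟨n, hn⟩ := ih
    by_cases hmem : k ∈ (spread c w N ε₀ Q i n).1
    · exact exists_receives_of_mem_spread hmem
    · refine ⟨n + 1, hmem, j, hn, ?_, hjk⟩
      rcases Nat.eq_zero_or_pos n with h0 | h1
      · exact Or.inl h0
      -- Acceptance would give a local move, so no receiver stops the message.
      · exact Or.inr fun ⟨v, hv, hle⟩ => not_lt_of_ge hle (neg_lt_offer h hpos h1 hn hv)

end Algorithm

/-! ### The swap estimate and the factor 5. -/

section Analysis

variable {V : Type*} {m : ℕ}

/-- The properties of the neighbour relation `N` in the configuration `Q` on which the analysis of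
the algorithm rests. -/
structure IsNeighbourRelation (c : V → V → ℝ) (Q : Fin m → V) (N : Fin m → Fin m → Prop) :
    Prop where
  refl : ∀ i, N i i
  -- Every vertex that gains from `i` moving within its cell lies in a neighbour's cell, so local
  -- sums miss no gain.
  of_lt : ∀ {i j u v}, u ∈ W c Q j → v ∈ W c Q i → c u v < c u (Q j) → N i j
  -- When `k` leaves, its neighbours serve its cell as well as all remaining robots would.
  exists_other : ∀ {k j u}, u ∈ W c Q k → j ≠ k → ∃ j', N k j' ∧ j' ≠ k ∧ c u (Q j') ≤ c u (Q j)
  -- Forwarded messages can reach every robot.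
  connected : ∀ i k, Relation.ReflTransGen N i k

variable {c : V → V → ℝ} {w : V → ℝ} {N : (Fin m → V) → Fin m → Fin m → Prop} {ε₀ : ℝ}
  {Q Qopt : Fin m → V} {σ τ : V → Fin m} {η : Fin m → Fin m}

theorem otherCost_le (hN : IsNeighbourRelation c Q (N Q)) {k j : Fin m} {u : V}
    (hu : u ∈ W c Q k) (hj : j ≠ k) : otherCost c N Q k u ≤ c u (Q j) := by
  obtain ⟨j', hkj', hne, hle⟩ := hN.exists_other hu hj
  exact (ciInf_le (Set.finite_range _).bddBelow (⟨j', hkj', hne⟩ : {j // N Q k j ∧ j ≠ k})).trans hle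

/-- The robot closest to the optimal location that serves `u` is a good substitute for the robot
that serves `u`. -/
theorem cost_closest_le (symm : ∀ u v, c u v = c v u) (tri : ∀ u v x, c u x ≤ c u v + c v x)
    (hη : ∀ l, Qopt l ∈ W c Q (η l)) (u : V) (j l : Fin m) :
    c u (Q (η l)) ≤ 2 * c u (Qopt l) + c u (Q j) := by
  have h1 := tri u (Qopt l) (Q (η l))
  have h2 := (hη l j).1
  have h3 := tri (Qopt l) u (Q j)
  have h4 := symm (Qopt l) u
  dsimp only at h2
  linarith

variable [Fintype V]

theorem cost_eq_sum (hw : ∀ v, 0 ≤ w v) (hσ : ∀ u, u ∈ W c Q (σ u)) :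
    cost c w Q = ∑ u, w u * c u (Q (σ u)) := by
  refine Finset.sum_congr rfl fun u _ => le_antisymm (ciInf_le (Set.finite_range _).bddBelow _) ?_
  have : Nonempty (Fin m) := ⟨σ u⟩
  exact le_ciInf fun j => mul_le_mul_of_nonneg_left (hσ u j).1 (hw u)

-- Each vertex lies in exactly one cell, so sums over cells become sums over vertices and can be
-- compared term by term.
open scoped Classical in
theorem sum_cells (hσ : ∀ u, u ∈ W c Q (σ u)) (T : Fin m → Prop)
    (R : Fin m → V → Prop) (F : Fin m → V → ℝ) :
    ∑ j with T j, ∑ u with u ∈ W c Q j ∧ R j u, F j u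
      = ∑ u, if T (σ u) ∧ R (σ u) u then F (σ u) u else 0 := by
  have hmem : ∀ u j, u ∈ W c Q j ↔ σ u = j := fun u j =>
    ⟨fun h => cell_unique (hσ u) h, fun h => h ▸ hσ u⟩
  simp only [hmem, Finset.sum_filter]
  calc ∑ j, (if T j then ∑ u, if σ u = j ∧ R j u then F j u else 0 else 0)
      = ∑ j, ∑ u, if σ u = j then (if T j ∧ R j u then F j u else 0) else 0 := by
        refine Finset.sum_congr rfl fun j _ => ?_
        by_cases hT : T j
        · simp only [hT, if_true, true_and, ite_and]
        · simp [hT]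
    _ = _ := by
        rw [Finset.sum_comm]
        exact Finset.sum_congr rfl fun u _ => by rw [Finset.sum_ite_eq]; simp

/-- The bound for the swap of the robot `s` against the optimal location `Qopt l`. -/
def swapBound (c : V → V → ℝ) (w : V → ℝ) (Q Qopt : Fin m → V) (σ τ : V → Fin m)
    (l s : Fin m) : ℝ :=
  (∑ u, if τ u = l then w u * (c u (Qopt l) - c u (Q (σ u))) else 0)
    + ∑ u, if σ u = s then 2 * (w u * c u (Qopt (τ u))) else 0

/-- Here `hs` says that the moving robot's cell holds no other optimal location. Hence a vertex `u`
of that cell with `τ u ≠ l` has the substitute `η (τ u) ≠ η l`, replaceable by a neighbour. Vertices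
outside the neighbours' cells contribute nothing on the left and, by `of_lt`, something nonnegative
on the right. -/
theorem delta_le_swapBound (symm : ∀ u v, c u v = c v u) (tri : ∀ u v x, c u x ≤ c u v + c v x)
    (nonneg : ∀ u v, 0 ≤ c u v) (hw : ∀ v, 0 ≤ w v) (hN : IsNeighbourRelation c Q (N Q))
    (hσ : ∀ u, u ∈ W c Q (σ u)) (hη : ∀ l, Qopt l ∈ W c Q (η l)) {l : Fin m}
    (hs : ∀ l', η l' = η l → l' = l) :
    delta c w N Q (η l) (Qopt l) ≤ swapBound c w Q Qopt σ τ l (η l) := by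
  classical
  have h := sum_cells (c := c) hσ (fun j => N Q (η l) j) (fun _ _ => True) (fun j u =>
    w u * ((⨅ k : {k // N Q (η l) k}, c u (Function.update Q (η l) (Qopt l) k)) - c u (Q j)))
  simp only [and_true] at h
  rw [delta, h, swapBound, ← Finset.sum_add_distrib]
  refine Finset.sum_le_sum fun u _ => ?_
  have hle : ∀ k, N Q (η l) k → (⨅ k : {k // N Q (η l) k},
      c u (Function.update Q (η l) (Qopt l) k)) ≤ c u (Function.update Q (η l) (Qopt l) k) :=
    fun k hk => ciInf_le (Set.finite_range _).bddBelow (⟨k, hk⟩ : {k // N Q (η l) k})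
  have hO := mul_nonneg (hw u) (nonneg u (Qopt (τ u)))
  have hOl : (if σ u = η l then 2 * (w u * c u (Qopt (τ u))) else 0) ≥ 0 := by
    split_ifs <;> linarith
  by_cases hT : N Q (η l) (σ u)
  · rw [if_pos hT]
    by_cases hτ : τ u = l
    · rw [if_pos hτ]
      have := hle (η l) (hN.refl _)
      rw [Function.update_self] at this
      have := mul_le_mul_of_nonneg_left (sub_le_sub_right this (c u (Q (σ u)))) (hw u)
      linarith
    · rw [if_neg hτ, zero_add]
      by_cases hσl : σ u = η l
      · rw [if_pos hσl]
        have hne : η (τ u) ≠ η l := fun h => hτ (hs _ h)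
        obtain ⟨j', hj', hne', hle'⟩ := hN.exists_other (hσl ▸ hσ u) hne
        have h1 := hle j' hj'
        rw [Function.update_of_ne hne'] at h1
        have h2 := cost_closest_le symm tri hη u (σ u) (τ u)
        have := mul_le_mul_of_nonneg_left
          (sub_le_iff_le_add.2 ((h1.trans hle').trans h2)) (hw u)
        linarith
      · rw [if_neg hσl]
        have h1 := hle (σ u) hT
        rw [Function.update_of_ne hσl] at h1
        exact mul_nonpos_of_nonneg_of_nonpos (hw u) (by linarith)
  · rw [if_neg hT]
    refine add_nonneg ?_ hOl
    split_ifs with hτ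
    · refine mul_nonneg (hw u) (sub_nonneg.2 (not_lt.1 fun hlt => hT ?_))
      exact hN.of_lt (hσ u) (hη l) hlt
    · exact le_rfl

/-- `rho` collects only strict gains, so it is below the first sum of the bound. The cell of `s`
holds no optimal location, so `η (τ u)` is always a substitute there. The near loss omits some
vertices and takes a further minimum, which keeps it below the same estimate. -/
theorem offer_le_swapBound (symm : ∀ u v, c u v = c v u) (tri : ∀ u v x, c u x ≤ c u v + c v x)
    (nonneg : ∀ u v, 0 ≤ c u v) (hw : ∀ v, 0 ≤ w v) (hN : IsNeighbourRelation c Q (N Q))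
    (hσ : ∀ u, u ∈ W c Q (σ u)) (hη : ∀ l, Qopt l ∈ W c Q (η l)) {l s : Fin m}
    (hs : ∀ l', η l' ≠ s) (n : ℕ) :
    offer c w N Q (η l) n s (Qopt l) ≤ swapBound c w Q Qopt σ τ l s := by
  classical
  have hmem : ∀ u j, u ∈ W c Q j ↔ σ u = j := fun u j =>
    ⟨fun h => cell_unique (hσ u) h, fun h => h ▸ hσ u⟩
  refine add_le_add ?_ ?_
  · rw [rho, sum_cells hσ (fun j => N Q (η l) j) (fun j u => c u (Qopt l) < c u (Q j))
      (fun j u => w u * (c u (Qopt l) - c u (Q j)))]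
    refine Finset.sum_le_sum fun u _ => ?_
    split_ifs with h1 h2 h2
    · exact le_rfl
    · exact mul_nonpos_of_nonneg_of_nonpos (hw u) (by linarith [h1.2])
    · exact mul_nonneg (hw u) (sub_nonneg.2 (not_lt.1 fun hlt =>
        h1 ⟨hN.of_lt (hσ u) (hη l) hlt, hlt⟩))
    · exact le_rfl
  · have hloss : ∀ u, σ u = s → w u * (otherCost c N Q s u - c u (Q s))
        ≤ 2 * (w u * c u (Qopt (τ u))) := by
      intro u hu
      have h1 := otherCost_le hN ((hmem u s).2 hu) (hs (τ u))
      have h2 := cost_closest_le symm tri hη u s (τ u)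
      have := mul_le_mul_of_nonneg_left (a := w u)
        (show otherCost c N Q s u - c u (Q s) ≤ 2 * c u (Qopt (τ u)) by linarith) (hw u)
      linarith
    have hO : ∀ u, 0 ≤ 2 * (w u * c u (Qopt (τ u))) := fun u =>
      mul_nonneg zero_le_two (mul_nonneg (hw u) (nonneg _ _))
    split_ifs with hn
    · rw [lossNear, Finset.sum_filter]
      refine Finset.sum_le_sum fun u _ => ?_
      simp only [hmem]
      by_cases h2 : σ u = s
      · rw [if_pos h2]
        split_ifs with h1
        · refine le_trans (mul_le_mul_of_nonneg_left ?_ (hw u)) (hloss u h2)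
          exact sub_le_sub_right (min_le_left _ _) _
        · exact hO u
      · simp [h2]
    · rw [lossFar, Finset.sum_filter]
      refine Finset.sum_le_sum fun u _ => ?_
      simp only [hmem]
      split_ifs with h1
      · exact hloss u h1
      · exact le_rfl

theorem swapBound_ge (symm : ∀ u v, c u v = c v u) (tri : ∀ u v x, c u x ≤ c u v + c v x)
    (nonneg : ∀ u v, 0 ≤ c u v) (hw : ∀ v, 0 ≤ w v) (hN : IsNeighbourRelation c Q (N Q))
    (hε : 0 < ε₀) (hQ : ∀ i Q', ¬ LocalMove c w N ε₀ i Q Q')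
    (hσ : ∀ u, u ∈ W c Q (σ u)) (hη : ∀ l, Qopt l ∈ W c Q (η l)) {l s : Fin m}
    (hs : ∀ l', η l' = s → l' = l) : -ε₀ ≤ swapBound c w Q Qopt σ τ l s := by
  classical
  by_cases hpos : 0 < ∑ u with u ∈ W c Q (η l), c u (Q (η l))
  · by_cases hsl : s = η l
    · subst hsl
      exact (neg_lt_delta (hQ _) hpos (hη l)).le.trans
        (delta_le_swapBound symm tri nonneg hw hN hσ hη hs)
    · obtain ⟨n, hn⟩ := exists_receives (hQ _) hpos (hN.connected (η l) s)
      have hn1 : 1 ≤ n := by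
        rcases Nat.eq_zero_or_pos n with rfl | h
        · exact (hsl hn).elim
        · exact h
      refine (neg_lt_offer (hQ _) hpos hn1 hn (hη l)).le.trans
        -- If some optimal location lay in the cell of `s`, it would be `Qopt l`, forcing `s = η l`.
        (offer_le_swapBound symm tri nonneg hw hN hσ hη (fun l' h => hsl ?_) n)
      rw [← h, hs l' h]
  -- A robot that does not enter the procedure is at cost zero from `Qopt l`, so no vertex is
  -- strictly closer to `Qopt l` than to its own robot, and the bound is nonnegative.
  · have hz : c (Qopt l) (Q (η l)) = 0 := by
      refine le_antisymm ?_ (nonneg _ _)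
      refine le_trans ?_ (not_lt.1 hpos)
      exact Finset.single_le_sum (f := fun u => c u (Q (η l))) (fun u _ => nonneg u _)
        (by simpa using hη l)
    refine (neg_nonpos.2 hε.le).trans (add_nonneg (Finset.sum_nonneg fun u _ => ?_)
      (Finset.sum_nonneg fun u _ => ?_))
    · split_ifs
      · refine mul_nonneg (hw u) (sub_nonneg.2 ?_)
        have h1 := (hσ u (η l)).1
        have h2 := tri u (Qopt l) (Q (η l))
        dsimp only at h1
        linarith
      · exact le_rfl
    · split_ifs
      · exact mul_nonneg zero_le_two (mul_nonneg (hw u) (nonneg _ _))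
      · exact le_rfl

/-- A configuration without local moves is a `5`-approximation up to `m * ε₀`. -/
theorem cost_le_of_not_localMove (hm : 0 < m) (symm : ∀ u v, c u v = c v u)
    (tri : ∀ u v x, c u x ≤ c u v + c v x) (nonneg : ∀ u v, 0 ≤ c u v) (hw : ∀ v, 0 ≤ w v)
    (hN : IsNeighbourRelation c Q (N Q)) (hε : 0 < ε₀)
    (hQ : ∀ i Q', ¬ LocalMove c w N ε₀ i Q Q') :
    cost c w Q ≤ 5 * cost c w Qopt + m * ε₀ := by
  classical
  choose σ hσ using exists_mem_cell (fun u j => c u (Q j)) hm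
  choose τ hτ using exists_mem_cell (fun u j => c u (Qopt j)) hm
  obtain ⟨s, hs, hs2⟩ := exists_swap_pairing fun l => σ (Qopt l)
  have hsum : ∑ _l : Fin m, -ε₀ ≤ ∑ l, swapBound c w Q Qopt σ τ l (s l) :=
    Finset.sum_le_sum fun l _ => swapBound_ge (η := fun l => σ (Qopt l)) symm tri nonneg hw hN hε hQ
      hσ (fun l => hσ _) (hs l)
  rw [cost_eq_sum hw hσ, cost_eq_sum hw hτ]
  have h1 : ∑ l, ∑ u, (if τ u = l then w u * (c u (Qopt l) - c u (Q (σ u))) else 0)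
      = ∑ u, w u * c u (Qopt (τ u)) - ∑ u, w u * c u (Q (σ u)) := by
    rw [Finset.sum_comm, ← Finset.sum_sub_distrib]
    refine Finset.sum_congr rfl fun u _ => ?_
    rw [Finset.sum_ite_eq, if_pos (Finset.mem_univ _), mul_sub]
  -- Two from rerouting, times two since each robot occurs in at most two swaps.
  have h2 : ∑ l, ∑ u, (if σ u = s l then 2 * (w u * c u (Qopt (τ u))) else 0)
      ≤ 4 * ∑ u, w u * c u (Qopt (τ u)) := by
    rw [Finset.sum_comm, Finset.mul_sum]
    refine Finset.sum_le_sum fun u _ => ?_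
    rw [← Finset.sum_filter, Finset.sum_const, nsmul_eq_mul]
    have hcard : ((Finset.univ.filter fun l => σ u = s l).card : ℝ) ≤ 2 := by
      have := hs2 (σ u)
      rw [Fintype.card_subtype] at this
      simp only [eq_comm (a := σ u)]
      exact_mod_cast this
    have hO := mul_nonneg zero_le_two (mul_nonneg (hw u) (nonneg u (Qopt (τ u))))
    have := mul_le_mul_of_nonneg_right hcard hO
    linarith
  simp only [swapBound] at hsum
  rw [Finset.sum_add_distrib, h1, Finset.sum_const, Finset.card_univ, Fintype.card_fin,
    nsmul_eq_mul] at hsum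
  linarith

/-- The approximation guarantee, from the properties of the cost and of the neighbour relation. -/
theorem approxGuarantee (hm : 0 < m) (symm : ∀ u v, c u v = c v u)
    (tri : ∀ u v x, c u x ≤ c u v + c v x) (nonneg : ∀ u v, 0 ≤ c u v) (hw : ∀ v, 0 ≤ w v)
    (hN : ∀ Q, IsNeighbourRelation c Q (N Q)) : ApproxGuarantee c w N := by
  have hfirst : ∀ ε₀ : ℝ, 0 < ε₀ → ∀ Q₀ Q Qopt : Fin m → V, TerminatesAt c w N ε₀ Q₀ Q →
      IsOptimal c w Qopt → cost c w Q ≤ 5 * cost c w Qopt + m * ε₀ :=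
    fun ε₀ hε Q₀ Q Qopt hterm _ =>
      cost_le_of_not_localMove hm symm tri nonneg hw (hN Q) hε hterm.not_localMove
  -- The error function can be zero: there are finitely many pairs of configurations, and for small
  -- `ε₀` the slack `m * ε₀` is below every positive gap between a cost and five times another.
  refine ⟨hfirst, fun _ => 0, isLittleO_zero _ _, ?_⟩
  have key : ∀ᶠ ε₀ in 𝓝[>] (0 : ℝ), ∀ x : (Fin m → V) × (Fin m → V),
      cost c w x.1 ≤ 5 * cost c w x.2 + m * ε₀ → cost c w x.1 ≤ 5 * cost c w x.2 := by
    rw [eventually_all]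
    intro x
    by_cases hx : cost c w x.1 ≤ 5 * cost c w x.2
    · exact Eventually.of_forall fun _ _ => hx
    · have hlim : Tendsto (fun ε : ℝ => 5 * cost c w x.2 + m * ε) (𝓝[>] 0)
          (𝓝 (5 * cost c w x.2 + m * 0)) :=
        tendsto_nhdsWithin_of_tendsto_nhds (Continuous.tendsto (by fun_prop) _)
      rw [mul_zero, add_zero] at hlim
      filter_upwards [hlim.eventually_lt_const (not_le.1 hx)] with ε hε hle
      exact (not_lt_of_ge hle hε).elim
  filter_upwards [key, self_mem_nhdsWithin] with ε₀ h hε Q₀ Q Qopt hterm hopt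
  rw [add_zero]
  exact h (Q, Qopt) (hfirst ε₀ hε Q₀ Q Qopt hterm hopt)

end Analysis

/-! ### The neighbour relation in a compact geodesic space. -/

section Environment

variable {X : Type*} [MetricSpace X]

theorem IsGeodesic.preconnectedSpace (hX : IsGeodesic X) : PreconnectedSpace X := by
  refine ⟨isPreconnected_of_forall_pair fun p _ q _ => ?_⟩
  obtain ⟨γ, h0, h1, hγ⟩ := hX p q
  have hcont : ContinuousOn γ (Set.Icc 0 (dist p q)) :=
    (LipschitzOnWith.of_dist_le_mul (K := 1) fun s hs t ht => by
      simp [hγ s hs t ht, Real.dist_eq]).continuousOn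
  exact ⟨γ '' Set.Icc 0 (dist p q), Set.subset_univ _, ⟨0, by simp, h0⟩,
    ⟨dist p q, by simp, h1⟩, isPreconnected_Icc.image _ hcont⟩

variable {S : Finset X} {m : ℕ} {Q : Fin m → S} {f : ℝ → ℝ}

theorem voronoiRadius_nonneg (i : Fin m) : 0 ≤ voronoiRadius Q i :=
  Real.sSup_nonneg (by rintro _ ⟨p, -, rfl⟩; exact dist_nonneg)

/-- Compactness bounds the set of distances, so `sSup` is a true supremum and not its default value
0. -/
theorem dist_le_voronoiRadius [CompactSpace X] {i : Fin m} {p : X} (hp : p ∈ voronoi Q i) :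
    dist p (Q i) ≤ voronoiRadius Q i := by
  refine le_csSup ?_ ⟨p, hp, rfl⟩
  obtain ⟨C, hC⟩ := Metric.isBounded_iff.1 (isCompact_univ (X := X)).isBounded
  exact ⟨C, by rintro _ ⟨p, -, rfl⟩; exact hC trivial trivial⟩

theorem isClosed_voronoi (i : Fin m) : IsClosed (voronoi Q i) := by
  simp only [voronoi, Set.ofPred_forall]
  exact isClosed_iInter fun j => isClosed_le (by fun_prop) (by fun_prop)

theorem envNeighbour_of_inter [CompactSpace X] {i j : Fin m} {p : X} (hi : p ∈ voronoi Q i)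
    (hj : p ∈ voronoi Q j) : EnvNeighbour Q i j := by
  have h1 := dist_le_voronoiRadius hi
  have h2 := dist_le_voronoiRadius hj
  have h3 := dist_triangle_left (Q i : X) (Q j) p
  have h4 := le_max_left (voronoiRadius Q i) (voronoiRadius Q j)
  have h5 := le_max_right (voronoiRadius Q i) (voronoiRadius Q j)
  have h6 := voronoiRadius_nonneg (Q := Q) i
  unfold EnvNeighbour
  linarith

theorem envCost_le_iff (hf : StrictMonoOn f (Set.Ici 0)) {u v u' v' : S} :
    envCost S f u v ≤ envCost S f u' v' ↔ dist (u : X) v ≤ dist (u' : X) v' :=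
  hf.le_iff_le dist_nonneg dist_nonneg

theorem mem_voronoi_of_mem_W (hf : StrictMonoOn f (Set.Ici 0)) {i : Fin m} {u : S}
    (hu : u ∈ W (envCost S f) Q i) : (u : X) ∈ voronoi Q i :=
  fun j => (envCost_le_iff hf).1 (hu j).1

/-- If the cell of robot `k` contains `p`, the closest other robot to `p` has a common point of its
cell with robot `k`. -/
theorem IsGeodesic.voronoi_inter_nonempty (hX : IsGeodesic X) {k j : Fin m} {p : X}
    (hp : p ∈ voronoi Q k) (hj : ∀ l, l ≠ k → dist p (Q j) ≤ dist p (Q l)) :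
    (voronoi Q k ∩ voronoi Q j).Nonempty := by
  obtain ⟨γ, h0, h1, hγ⟩ := hX p (Q j)
  have hcont : ContinuousOn γ (Set.Icc 0 (dist p (Q j))) :=
    (LipschitzOnWith.of_dist_le_mul (K := 1) fun s hs t ht => by
      simp [hγ s hs t ht, Real.dist_eq]).continuousOn
  have hL : (0 : ℝ) ≤ dist p (Q j) := dist_nonneg
  -- Intermediate value theorem on the geodesic from `p` to `Q j`, for the difference of the
  -- distances to robots `k` and `j`.
  obtain ⟨s, hs, hz⟩ : (0 : ℝ) ∈
      (fun s => dist (γ s) (Q k : X) - dist (γ s) (Q j : X)) '' Set.Icc 0 (dist p (Q j)) := by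
    refine intermediate_value_Icc hL (by fun_prop) ⟨?_, ?_⟩
    · simpa [h0] using hp j
    · simp [h1]
  have hd : dist (γ s) (Q j : X) ≤ dist p (Q j) - s := by
    have := hγ s hs _ (Set.right_mem_Icc.2 hL)
    rw [h1, abs_sub_comm, abs_of_nonneg (sub_nonneg.2 hs.2)] at this
    exact this.le
  have hd' : dist p (γ s) = s := by
    have := hγ 0 (Set.left_mem_Icc.2 hL) s hs
    rwa [h0, zero_sub, abs_neg, abs_of_nonneg hs.1] at this
  -- Moving by `s` towards `Q j` shortens the distance to `Q j` by `s` and any other by at most `s`,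
  -- so `j` stays closest among the others.
  have hother : ∀ l, l ≠ k → dist (γ s) (Q j : X) ≤ dist (γ s) (Q l) := fun l hl => by
    have := dist_triangle p (γ s) (Q l)
    have := hj l hl
    linarith
  have heq : dist (γ s) (Q k : X) = dist (γ s) (Q j : X) := sub_eq_zero.1 hz
  have hmem : γ s ∈ voronoi Q j := fun l => by
    by_cases hl : l = k
    · rw [hl, heq]
    · exact hother l hl
  exact ⟨γ s, fun l => heq ▸ hmem l, hmem⟩

theorem isNeighbourRelation_env [CompactSpace X] (hm : 0 < m) (hX : IsGeodesic X)
    (hf : StrictMonoOn f (Set.Ici 0)) (Q : Fin m → S) :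
    IsNeighbourRelation (envCost S f) Q (EnvNeighbour Q) where
  refl i := by
    have := voronoiRadius_nonneg (Q := Q) i
    simpa [EnvNeighbour] using this
  -- The route `Q i`, `v`, `u`, `Q j` is at most `r_i + r_j + r_j` long.
  of_lt {i j u v} hu hv hlt := by
    have h1 := dist_le_voronoiRadius (mem_voronoi_of_mem_W hf hu)
    have h2 := dist_le_voronoiRadius (mem_voronoi_of_mem_W hf hv)
    have h3 := not_le.1 (mt (envCost_le_iff hf).2 (not_le_of_gt hlt))
    have h4 := dist_triangle4 (Q i : X) v u (Q j)
    have h5 := le_max_left (voronoiRadius Q i) (voronoiRadius Q j)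
    have h6 := le_max_right (voronoiRadius Q i) (voronoiRadius Q j)
    have h7 := voronoiRadius_nonneg (Q := Q) i
    rw [dist_comm (v : X) u, dist_comm (Q i : X) v] at h4
    unfold EnvNeighbour
    linarith
  exists_other {k j u} hu hj := by
    obtain ⟨j', hne, hj'⟩ := exists_closest (fun u j => envCost S f u (Q j)) u (· ≠ k) ⟨j, hj⟩
    obtain ⟨p, hpk, hpj⟩ := hX.voronoi_inter_nonempty (mem_voronoi_of_mem_W hf hu)
      fun l hl => (envCost_le_iff hf).1 (hj' l hl).1
    exact ⟨j', envNeighbour_of_inter hpk hpj, hne, (hj' j hj).1⟩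
  connected i k := by
    by_contra hk
    have := hX.preconnectedSpace
    -- The cells of robots reachable from `i` and those of the others form two closed sets covering
    -- the connected space `X`; a common point would make a reachable robot and an unreachable one
    -- neighbours.
    let C : Set (Fin m) := {j | Relation.ReflTransGen (EnvNeighbour Q) i j}
    have hclosed : ∀ T : Set (Fin m), IsClosed (⋃ j ∈ T, voronoi Q j) := fun T =>
      T.toFinite.isClosed_biUnion fun j _ => isClosed_voronoi j
    have hself : ∀ j, (Q j : X) ∈ voronoi Q j := fun j l => by simp
    obtain ⟨p, -, hp1, hp2⟩ := isPreconnected_closed_iff.1 (isPreconnected_univ (α := X)) _ _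
      (hclosed C) (hclosed Cᶜ) (fun p _ => by
        obtain ⟨j, hj⟩ := exists_mem_cell (fun (p : X) j => dist p (Q j)) hm p
        have hpj : p ∈ voronoi Q j := fun l => (hj l).1
        by_cases hjC : j ∈ C
        · exact Or.inl (Set.mem_biUnion hjC hpj)
        · exact Or.inr (Set.mem_biUnion hjC hpj))
      ⟨Q i, trivial, Set.mem_biUnion (Relation.ReflTransGen.refl : i ∈ C) (hself i)⟩
      ⟨Q k, trivial, Set.mem_biUnion (show k ∈ Cᶜ from hk) (hself k)⟩
    simp only [Set.mem_iUnion] at hp1 hp2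
    obtain ⟨a, ha, hpa⟩ := hp1
    obtain ⟨b, hb, hpb⟩ := hp2
    exact hb (Relation.ReflTransGen.tail ha (envNeighbour_of_inter hpa hpb))

end Environment

/-! ### Shortest walks and cells in a weighted graph. -/

section GraphDist

variable {P : Type*} {H : SimpleGraph P} {len : P → P → ℝ}

/-- The length of a walk. -/
def walkLen (len : P → P → ℝ) {a b : P} (p : H.Walk a b) : ℝ :=
  (p.darts.map fun d => len d.fst d.snd).sum

@[simp]
theorem walkLen_nil (a : P) : walkLen len (.nil : H.Walk a a) = 0 := rfl

@[simp]
theorem walkLen_cons {a b d : P} (h : H.Adj a b) (p : H.Walk b d) :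
    walkLen len (.cons h p) = len a b + walkLen len p := by simp [walkLen]

theorem walkLen_nonneg (hnn : ∀ x y, H.Adj x y → 0 ≤ len x y) {a b : P} (p : H.Walk a b) :
    0 ≤ walkLen len p := by
  refine List.sum_nonneg fun r hr => ?_
  obtain ⟨d, -, rfl⟩ := List.mem_map.1 hr
  exact hnn _ _ d.adj

theorem graphDist_le (hnn : ∀ x y, H.Adj x y → 0 ≤ len x y) {a b : P} (p : H.Walk a b) :
    graphDist H len a b ≤ walkLen len p :=
  ciInf_le ⟨0, by rintro _ ⟨q, rfl⟩; exact walkLen_nonneg hnn q⟩ p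

theorem graphDist_nonneg (hnn : ∀ x y, H.Adj x y → 0 ≤ len x y) (a b : P) :
    0 ≤ graphDist H len a b :=
  Real.iInf_nonneg fun p => walkLen_nonneg hnn p

theorem graphDist_self (hnn : ∀ x y, H.Adj x y → 0 ≤ len x y) (a : P) :
    graphDist H len a a = 0 :=
  le_antisymm (by simpa using graphDist_le hnn (.nil : H.Walk a a)) (graphDist_nonneg hnn a a)

/-- Shortest walks exist. -/
theorem exists_walkLen_eq [Finite P] (hH : H.Connected) (hnn : ∀ x y, H.Adj x y → 0 ≤ len x y)
    (a b : P) : ∃ p : H.Walk a b, walkLen len p = graphDist H len a b := by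
  classical
  have := Fintype.ofFinite P
  obtain ⟨p₀⟩ := hH.preconnected a b
  have : Nonempty (H.Path a b) := ⟨p₀.toPath⟩
  have : Nonempty (H.Walk a b) := ⟨p₀⟩
  -- There are finitely many paths, and bypassing loops turns a walk into a path that is no longer.
  obtain ⟨p, hp⟩ := Finite.exists_min fun p : H.Path a b => walkLen len p.1
  refine ⟨p.1, le_antisymm (le_ciInf fun q => (hp q.toPath).trans ?_) (graphDist_le hnn p.1)⟩
  refine (q.darts_bypass_sublist_darts.map _).sum_le_sum fun r hr => ?_
  obtain ⟨d, -, rfl⟩ := List.mem_map.1 hr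
  exact hnn _ _ d.adj

theorem graphDist_comm [Finite P] (hH : H.Connected) (hnn : ∀ x y, H.Adj x y → 0 ≤ len x y)
    (hsymm : ∀ x y, len x y = len y x) (a b : P) : graphDist H len a b = graphDist H len b a := by
  have key : ∀ a b, graphDist H len a b ≤ graphDist H len b a := by
    intro a b
    obtain ⟨p, hp⟩ := exists_walkLen_eq hH hnn b a
    rw [← hp]
    refine (graphDist_le hnn p.reverse).trans_eq ?_
    simp only [walkLen, SimpleGraph.Walk.darts_reverse, List.map_reverse, List.sum_reverse,
      List.map_map]
    exact congrArg List.sum (List.map_congr_left fun d _ => hsymm _ _)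
  exact le_antisymm (key a b) (key b a)

theorem graphDist_triangle [Finite P] (hH : H.Connected)
    (hnn : ∀ x y, H.Adj x y → 0 ≤ len x y) (a b d : P) :
    graphDist H len a d ≤ graphDist H len a b + graphDist H len b d := by
  obtain ⟨p, hp⟩ := exists_walkLen_eq hH hnn a b
  obtain ⟨q, hq⟩ := exists_walkLen_eq hH hnn b d
  rw [← hp, ← hq]
  refine (graphDist_le hnn (p.append q)).trans_eq ?_
  simp [walkLen]

theorem graphDist_le_of_adj (hnn : ∀ x y, H.Adj x y → 0 ≤ len x y) {a b : P} (h : H.Adj a b) :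
    graphDist H len a b ≤ len a b := by
  simpa [SimpleGraph.Adj.toWalk] using graphDist_le hnn h.toWalk

variable {m : ℕ} {x : Fin m → P}

/-- Along a shortest walk from the cell of robot `k` to the closest other robot `j`, the cells of
these robots are adjacent, or robot `j` is reached in the cell of robot `k`. -/
theorem exists_adj_cells [Finite P] (hm : 0 < m) (hH : H.Connected)
    (hnn : ∀ x y, H.Adj x y → 0 ≤ len x y) {k j : Fin m} {a t : P} (p : H.Walk a t) (ht : t = x j)
    (hp : walkLen len p = graphDist H len a t)
    (ha : a ∈ cell (fun q i => graphDist H len q (x i)) k)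
    (hj : ∀ l, l ≠ k → graphDist H len a (x j) ≤ graphDist H len a (x l) ∧
      (l < j → graphDist H len a (x j) < graphDist H len a (x l))) :
    x j ∈ cell (fun q i => graphDist H len q (x i)) k ∨
      ∃ a b, H.Adj a b ∧ a ∈ cell (fun q i => graphDist H len q (x i)) k ∧
        b ∈ cell (fun q i => graphDist H len q (x i)) j := by
  induction p with
  | nil => exact Or.inl (ht ▸ ha)
  | @cons a b t h p ih =>
    have h1 := graphDist_le hnn p
    have h2 : ∀ y, graphDist H len a y ≤ len a b + graphDist H len b y := fun y =>
      (graphDist_triangle hH hnn a b y).trans (add_le_add_left (graphDist_le_of_adj hnn h) _)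
    have h3 := h2 t
    rw [walkLen_cons] at hp
    -- A step along a shortest walk to `x j` lowers that distance by the full edge length and every
    -- other by at most as much, so `j` keeps winning, ties included.
    have hb : ∀ l, l ≠ k → graphDist H len b (x j) ≤ graphDist H len b (x l) ∧
        (l < j → graphDist H len b (x j) < graphDist H len b (x l)) := by
      intro l hl
      have h4 := h2 (x l)
      obtain ⟨h5, h6⟩ := hj l hl
      rw [← ht] at h5 h6 ⊢
      exact ⟨by linarith, fun hlj => by linarith [h6 hlj]⟩
    obtain ⟨l, hl⟩ := exists_mem_cell (fun q i => graphDist H len q (x i)) hm b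
    by_cases hlk : l = k
    · exact ih ht (by linarith) (hlk ▸ hl) hb
    · refine Or.inr ⟨a, b, h, ha, ?_⟩
      rcases lt_trichotomy l j with hlt | rfl | hlt
      · exact (not_lt_of_ge (hl j).1 ((hb l hlk).2 hlt)).elim
      · exact hl
      · exact (not_lt_of_ge (hb l hlk).1 ((hl j).2 hlt)).elim

end GraphDist

/-! ### The neighbour relation in a graph with midpoints on its edges. -/

section Graph

variable {V : Type*} {G : SimpleGraph V} {len : Sym2 V → ℝ}

theorem subdivision_connected (hG : G.Connected) : (subdivision G).Connected := by
  have hinl : ∀ u v, (subdivision G).Reachable (.inl u) (.inl v) := by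
    intro u v
    obtain ⟨p⟩ := hG.preconnected u v
    induction p with
    | nil => exact .rfl
    | @cons u x v h p ih =>
      let e : G.edgeSet := ⟨s(u, x), h⟩
      have h1 : (subdivision G).Adj (.inl u) (.inr e) := Sym2.mem_mk_left u x
      have h2 : (subdivision G).Adj (.inr e) (.inl x) := Sym2.mem_mk_right u x
      exact h1.reachable.trans (h2.reachable.trans ih)
  obtain ⟨v⟩ := hG.nonempty
  have hv : ∀ p, (subdivision G).Reachable p (.inl v) := by
    rintro (u | e)
    · exact hinl u v
    · have h : (subdivision G).Adj (.inr e) (.inl e.1.out.1) := e.1.out_fst_mem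
      exact h.reachable.trans (hinl _ _)
  have : Nonempty (V ⊕ G.edgeSet) := ⟨.inl v⟩
  exact ⟨fun p q => (hv p).trans (hv q).symm⟩

theorem subdivisionLen_nonneg (hlen : ∀ e ∈ G.edgeSet, 0 ≤ len e) (p q : V ⊕ G.edgeSet)
    (_ : (subdivision G).Adj p q) : 0 ≤ subdivisionLen G len p q := by
  rcases p with u | e <;> rcases q with v | e' <;> simp only [subdivisionLen] <;>
    first | exact le_rfl | exact div_nonneg (hlen _ (Subtype.property _)) zero_le_two

theorem subdivisionLen_comm (p q : V ⊕ G.edgeSet) :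
    subdivisionLen G len p q = subdivisionLen G len q p := by
  rcases p with u | e <;> rcases q with v | e' <;> rfl

theorem adj_len_nonneg (hlen : ∀ e ∈ G.edgeSet, 0 ≤ len e) (x y : V) (h : G.Adj x y) :
    0 ≤ len s(x, y) := hlen _ h

variable {m : ℕ} {Q : Fin m → V}

theorem cellRadius_nonneg (hlen : ∀ e ∈ G.edgeSet, 0 ≤ len e) (i : Fin m) :
    0 ≤ cellRadius G len Q i :=
  Real.sSup_nonneg (by rintro _ ⟨p, -, rfl⟩; exact graphDist_nonneg (subdivisionLen_nonneg hlen) _ _)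

variable [Finite V]

/-- The induction passes through midpoints, where the statement must record the end `x` by which the
walk leaves. -/
theorem graphCost_le_walkLen (hG : G.Connected) (hlen : ∀ e ∈ G.edgeSet, 0 ≤ len e)
    {a b : V ⊕ G.edgeSet} (p : (subdivision G).Walk a b) {v : V} (hb : b = .inl v) :
    match a with
    | .inl u => graphCost G len u v ≤ walkLen (subdivisionLen G len) p
    | .inr e => ∃ x ∈ e.1, len e.1 / 2 + graphCost G len x v
        ≤ walkLen (subdivisionLen G len) p := by
  have hnn := adj_len_nonneg hlen
  induction p with
  | nil =>
    subst hb
    exact (graphDist_self hnn v).le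
  | @cons a d b h p ih =>
    have ih := ih hb
    rcases a with u | e <;> rcases d with u' | e'
    · exact h.elim
    · obtain ⟨x, hx, hle⟩ := ih
      have hu : u ∈ e'.1 := h
      have h0 := hlen _ e'.2
      have key : graphCost G len u v ≤ len e'.1 + graphCost G len x v := by
        -- Two consecutive halves either return to the same end, which costs nonnegative length, or
        -- traverse the edge.
        by_cases hux : u = x
        · subst hux
          linarith
        · have he : e'.1 = s(u, x) := (Sym2.mem_and_mem_iff hux).1 ⟨hu, hx⟩
          have hadj : G.Adj u x := by
            rw [← SimpleGraph.mem_edgeSet, ← he]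
            exact e'.2
          have h1 := graphDist_triangle hG hnn u x v
          have h2 := graphDist_le_of_adj hnn hadj
          rw [← he] at h2
          exact h1.trans (add_le_add_left h2 _)
      dsimp only
      rw [walkLen_cons]
      change _ ≤ len e'.1 / 2 + _
      linarith
    · refine ⟨u', h, ?_⟩
      rw [walkLen_cons]
      exact add_le_add_right ih (len e.1 / 2)
    · exact h.elim

/-- The distance of the subdivision extends the cost of the graph. -/
theorem graphDist_subdivision (hG : G.Connected) (hlen : ∀ e ∈ G.edgeSet, 0 ≤ len e) (u v : V) :
    graphDist (subdivision G) (subdivisionLen G len) (.inl u) (.inl v) = graphCost G len u v := by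
  have hH := subdivision_connected hG
  have hnn := subdivisionLen_nonneg hlen
  refine le_antisymm ?_ ?_
  · obtain ⟨p, hp⟩ := exists_walkLen_eq hG (adj_len_nonneg hlen) u v
    rw [graphCost, ← hp]
    clear hp
    induction p with
    | nil => exact (graphDist_self hnn _).le
    | @cons u x v h p ih =>
      let e : G.edgeSet := ⟨s(u, x), h⟩
      have h1 : (subdivision G).Adj (.inl u) (.inr e) := Sym2.mem_mk_left u x
      have h2 : (subdivision G).Adj (.inr e) (.inl x) := Sym2.mem_mk_right u x
      have h3 := graphDist_triangle hH hnn (.inl u) (.inr e) (.inl v)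
      have h4 := graphDist_triangle hH hnn (.inr e) (.inl x) (.inl v)
      have h5 : _ ≤ len s(u, x) / 2 := graphDist_le_of_adj hnn h1
      have h6 : _ ≤ len s(u, x) / 2 := graphDist_le_of_adj hnn h2
      rw [walkLen_cons]
      linarith
  · obtain ⟨p, hp⟩ := exists_walkLen_eq hH hnn (.inl u) (.inl v)
    rw [← hp]
    exact graphCost_le_walkLen hG hlen p rfl

theorem half_len_le_robotDist (hG : G.Connected) (hlen : ∀ e ∈ G.edgeSet, 0 ≤ len e)
    (e : G.edgeSet) (j : Fin m) : len e.1 / 2 ≤ robotDist G len Q (.inr e) j := by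
  obtain ⟨p, hp⟩ := exists_walkLen_eq (subdivision_connected hG) (subdivisionLen_nonneg hlen)
    (.inr e) (.inl (Q j))
  obtain ⟨x, -, hx⟩ := graphCost_le_walkLen hG hlen p rfl
  have : 0 ≤ graphCost G len x (Q j) := graphDist_nonneg (adj_len_nonneg hlen) _ _
  rw [robotDist, ← hp]
  linarith

theorem robotDist_le_cellRadius {i : Fin m} {p : V ⊕ G.edgeSet}
    (hp : p ∈ cell (robotDist G len Q) i) : robotDist G len Q p i ≤ cellRadius G len Q i :=
  le_csSup (Set.toFinite _).bddAbove ⟨p, hp, rfl⟩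

theorem inl_mem_cell (hG : G.Connected) (hlen : ∀ e ∈ G.edgeSet, 0 ≤ len e) {u : V} {i : Fin m} :
    .inl u ∈ cell (robotDist G len Q) i ↔ u ∈ W (graphCost G len) Q i := by
  simp only [W, cell, robotDist, graphDist_subdivision hG hlen, Set.mem_ofPred_eq]

theorem graphCost_le_cellRadius (hG : G.Connected) (hlen : ∀ e ∈ G.edgeSet, 0 ≤ len e) {u : V}
    {i : Fin m} (hu : u ∈ W (graphCost G len) Q i) :
    graphCost G len u (Q i) ≤ cellRadius G len Q i := by
  rw [← graphDist_subdivision hG hlen]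
  exact robotDist_le_cellRadius ((inl_mem_cell hG hlen).2 hu)

theorem GraphNeighbour.symm (hG : G.Connected) (hlen : ∀ e ∈ G.edgeSet, 0 ≤ len e) {i j : Fin m}
    (h : GraphNeighbour G len Q i j) : GraphNeighbour G len Q j i := by
  rw [GraphNeighbour, max_comm, graphCost,
    graphDist_comm hG (adj_len_nonneg hlen) fun x y => by rw [Sym2.eq_swap]]
  exact h

theorem graphNeighbour_of_mem_W (hG : G.Connected) (hlen : ∀ e ∈ G.edgeSet, 0 ≤ len e)
    {i j : Fin m} (h : Q j ∈ W (graphCost G len) Q i) : GraphNeighbour G len Q j i := by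
  have h1 := graphCost_le_cellRadius hG hlen h
  have h2 := le_max_right (cellRadius G len Q j) (cellRadius G len Q i)
  have h3 := cellRadius_nonneg (Q := Q) hlen i
  unfold GraphNeighbour
  linarith

/-- The purpose of the midpoints: one of `a`, `b` is a midpoint, and its distance to its own robot
is at least half its edge. So the half edge `ab` is at most the larger radius, and the robots are at
most three such radii apart. -/
theorem graphNeighbour_of_adj (hG : G.Connected) (hlen : ∀ e ∈ G.edgeSet, 0 ≤ len e)
    {i j : Fin m} {a b : V ⊕ G.edgeSet} (hab : (subdivision G).Adj a b)
    (ha : a ∈ cell (robotDist G len Q) i) (hb : b ∈ cell (robotDist G len Q) j) :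
    GraphNeighbour G len Q i j := by
  have hH := subdivision_connected hG
  have hnn := subdivisionLen_nonneg (G := G) hlen
  have h1 := graphDist_triangle hH hnn (.inl (Q i)) a (.inl (Q j))
  have h2 := graphDist_triangle hH hnn a b (.inl (Q j))
  have h3 := graphDist_le_of_adj hnn hab
  have h4 := robotDist_le_cellRadius ha
  have h5 := robotDist_le_cellRadius hb
  have h6 := le_max_left (cellRadius G len Q i) (cellRadius G len Q j)
  have h7 := le_max_right (cellRadius G len Q i) (cellRadius G len Q j)
  have h8 := cellRadius_nonneg (Q := Q) hlen i
  have h9 : subdivisionLen G len a b ≤ max (cellRadius G len Q i) (cellRadius G len Q j) := by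
    rcases a with u | e <;> rcases b with v | e'
    · exact hab.elim
    · exact (half_len_le_robotDist hG hlen e' j).trans (h5.trans h7)
    · exact (half_len_le_robotDist hG hlen e i).trans (h4.trans h6)
    · exact hab.elim
  rw [graphDist_comm hH hnn subdivisionLen_comm (.inl (Q i)) a,
    graphDist_subdivision hG hlen] at h1
  unfold GraphNeighbour
  unfold robotDist at h4 h5
  linarith

theorem isNeighbourRelation_graph (hm : 0 < m) (hG : G.Connected)
    (hlen : ∀ e ∈ G.edgeSet, 0 ≤ len e) (Q : Fin m → V) :
    IsNeighbourRelation (graphCost G len) Q (GraphNeighbour G len Q) where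
  refl i := by
    have h1 := cellRadius_nonneg (Q := Q) hlen i
    have h2 : graphCost G len (Q i) (Q i) = 0 := graphDist_self (adj_len_nonneg hlen) _
    simpa [GraphNeighbour, h2] using h1
  of_lt {i j u v} hu hv hlt := by
    have h1 := graphCost_le_cellRadius hG hlen hu
    have h2 := graphCost_le_cellRadius hG hlen hv
    have hnn := adj_len_nonneg (len := len) hlen
    have h3 : graphCost G len (Q i) (Q j) ≤ _ := graphDist_triangle hG hnn (Q i) v (Q j)
    have h4 : graphCost G len v (Q j) ≤ _ := graphDist_triangle hG hnn v u (Q j)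
    have h5 := le_max_left (cellRadius G len Q i) (cellRadius G len Q j)
    have h6 := le_max_right (cellRadius G len Q i) (cellRadius G len Q j)
    have h7 := cellRadius_nonneg (Q := Q) hlen i
    have hcomm := graphDist_comm hG hnn fun x y => by rw [Sym2.eq_swap]
    rw [hcomm] at h3
    rw [hcomm v u] at h4
    unfold GraphNeighbour
    unfold graphCost at *
    linarith
  exists_other {k j u} hu hj := by
    obtain ⟨j', hne, hj'⟩ := exists_closest (fun u j => graphCost G len u (Q j)) u (· ≠ k) ⟨j, hj⟩
    refine ⟨j', ?_, hne, (hj' j hj).1⟩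
    have hH := subdivision_connected hG
    have hnn := subdivisionLen_nonneg (G := G) hlen
    obtain ⟨p, hp⟩ := exists_walkLen_eq hH hnn (.inl u) (.inl (Q j'))
    rcases exists_adj_cells (x := fun i => Sum.inl (Q i)) hm hH hnn p rfl hp
      ((inl_mem_cell hG hlen).2 hu)
      (by simpa only [graphDist_subdivision hG hlen] using hj') with h | ⟨a, b, hab, ha, hb⟩
    · exact (graphNeighbour_of_mem_W hG hlen ((inl_mem_cell hG hlen).1 h)).symm hG hlen
    · exact graphNeighbour_of_adj hG hlen hab ha hb
  connected i k := by
    have key : ∀ {a b : V ⊕ G.edgeSet} (_ : (subdivision G).Walk a b) {i k : Fin m},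
        a ∈ cell (robotDist G len Q) i → b ∈ cell (robotDist G len Q) k →
        Relation.ReflTransGen (GraphNeighbour G len Q) i k := by
      intro a b p
      induction p with
      | nil =>
        intro i k hi hk
        rw [cell_unique hi hk]
      | @cons a d b h p ih =>
        intro i k hi hk
        obtain ⟨j, hj⟩ := exists_mem_cell (robotDist G len Q) hm d
        exact Relation.ReflTransGen.head (graphNeighbour_of_adj hG hlen h hi hj) (ih hj hk)
    -- With coinciding positions or edges of cost zero, `Q i` may belong to the cell of another
    -- robot, so the chain of cells starts at the owner `i'` and ends at the owner `k'`.
    obtain ⟨i', hi'⟩ := exists_mem_cell (robotDist G len Q) hm (.inl (Q i))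
    obtain ⟨k', hk'⟩ := exists_mem_cell (robotDist G len Q) hm (.inl (Q k))
    obtain ⟨p⟩ := (subdivision_connected hG).preconnected (.inl (Q i)) (.inl (Q k))
    have hi := graphNeighbour_of_mem_W hG hlen ((inl_mem_cell hG hlen).1 hi')
    have hk := (graphNeighbour_of_mem_W hG hlen ((inl_mem_cell hG hlen).1 hk')).symm hG hlen
    exact Relation.ReflTransGen.head hi ((key p hi' hk').tail hk)

end Graph

end Coverage

theorem theorem2 (m : ℕ) (hm : 0 < m) :
    -- a metric graph, with neighbours defined through the graph
    (∀ (V : Type*) [Fintype V] (G : SimpleGraph V) (len : Sym2 V → ℝ) (w : V → ℝ),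
      G.Connected → (∀ e ∈ G.edgeSet, 0 ≤ len e) → (∀ v, 0 ≤ w v) →
      Coverage.ApproxGuarantee (m := m) (Coverage.graphCost G len) w
        (Coverage.GraphNeighbour G len)) ∧
    -- the metric graph of a finite sample of a continuous environment, with neighbours defined
    -- through the environment, for an increasing subadditive sensing function
    (∀ (X : Type*) [MetricSpace X] [CompactSpace X] (S : Finset X) (f : ℝ → ℝ) (w : S → ℝ),
      Coverage.IsGeodesic X →
      (∀ x, 0 ≤ x → 0 ≤ f x) → StrictMonoOn f (Set.Ici 0) →
      (∀ x y, 0 ≤ x → 0 ≤ y → f (x + y) ≤ f x + f y) → (∀ v, 0 ≤ w v) →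
      Coverage.ApproxGuarantee (m := m) (Coverage.envCost S f) w Coverage.EnvNeighbour) := by
  constructor
  · intro V _ G len w hG hlen hw
    have hnn := Coverage.adj_len_nonneg hlen
    exact Coverage.approxGuarantee hm
      (Coverage.graphDist_comm hG hnn fun x y => by rw [Sym2.eq_swap])
      (Coverage.graphDist_triangle hG hnn) (Coverage.graphDist_nonneg hnn) hw
      (Coverage.isNeighbourRelation_graph hm hG hlen)
  · intro X _ _ S f w hX hf0 hf hsub hw
    refine Coverage.approxGuarantee hm (fun u v => ?_) (fun u v x => ?_) (fun u v => ?_) hw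
      (Coverage.isNeighbourRelation_env hm hX hf)
    · rw [Coverage.envCost, dist_comm, Coverage.envCost]
    · exact (hf.monotoneOn dist_nonneg (add_nonneg dist_nonneg dist_nonneg)
        (dist_triangle _ _ _)).trans (hsub _ _ dist_nonneg dist_nonneg)
    · exact hf0 _ dist_nonneg
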